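/- For $\alpha\in\mathbb R$ and $k\in\mathbb N_0$ let $\binom{\alpha}{k}=\frac{\alpha(\alpha-1)\cdots(\alpha-k+1)}{k!}$ (with $\binom{\alpha}{0}=1$). Define the indices of coincidence $$U_n(x)=\sum_{k=0}^{n}\Big(\binom nk x^k(1+x)^{-n}\Big)^2\quad (n\in\mathbb N_0,\ x\ge 0),$$ $$G_n(x)=\sum_{k=0}^{\infty}\Big(\binom{n+k-1}{k} x^k(1+x)^{-n-k}\Big)^2\quad (n\in[0,\infty),\ x\ge 0),$$ $$J_n(x)=\sum_{k=0}^{\infty}\Big(\binom{n+k}{k} x^k(1-x)^{n+1}\Big)^2\quad (n\in[0,\infty),\ 0\le x<1)$$ of the Bleimann–Butzer–Hahn, negative binomial (Baskakov) and Meyer-König–Zeller distributions. The series defining $G_n(x)$ and $J_n(x)$ converge, and the following inequalities hold. (a) For every integer $n\ge 1$ and every $x\ge 0$, $$2U_n(x)\le U_{n-1}(x)+U_{n+1}(x),$$ $$U_{n+1}(x)\le\frac{1+4nx+x^2}{1+(4n+4)x+x^2}\,U_{n-1}(x),\qquad U_n(x)\le\frac{1+(4n+2)x+x^2}{1+(4n+4)x+x^2}\,U_{n-1}(x).$$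 (b) For every real $n\ge 1$ (in particular every integer $n\ge1$) and every $x\ge 0$, $$2G_n(x)\le G_{n-1}(x)+G_{n+1}(x),$$ $$G_{n+1}(x)\le\frac{1+(4n-2)x(1+x)}{1+(4n+2)x(1+x)}\,G_{n-1}(x),\qquad G_n(x)\le\frac{1+4nx(x+1)}{1+(4n+2)x(x+1)}\,G_{n-1}(x).$$ (c) For every real $n\ge 1$ (in particular every integer $n\ge1$) and every $x\in[0,1)$, $$2J_n(x)\le J_{n-1}(x)+J_{n+1}(x),$$ $$J_{n+1}(x)\le\frac{1+4nx+x^2}{1+(4n+4)x+x^2}\,J_{n-1}(x),\qquad J_n(x)\le\frac{1+(4n+2)x+x^2}{1+(4n+4)x+x^2}\,J_{n-1}(x).$$ -/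

import Mathlib

noncomputable section

/-- The index of coincidence of the Bleimann-Butzer-Hahn distribution
`(C(n,k) x^k (1+x)^(-n))_{k=0,...,n}`, for `x ≥ 0`. -/
def indexU (n : ℕ) (x : ℝ) : ℝ :=
  ∑ k ∈ Finset.range (n + 1), ((n.choose k : ℝ) * x ^ k / (1 + x) ^ n) ^ 2

/-- The weights `C(n+k-1,k) x^k (1+x)^(-n-k)` of the negative binomial distribution, with a real
parameter `n` and `x ≥ 0`; `Ring.choose` is the generalized binomial coefficient
`α (α-1) ⋯ (α-k+1) / k!`. -/
def weightG (n x : ℝ) (k : ℕ) : ℝ :=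
  Ring.choose (n + (k : ℝ) - 1) k * x ^ k * (1 + x) ^ (-n - (k : ℝ))

/-- The index of coincidence of the negative binomial distribution. -/
def indexG (n x : ℝ) : ℝ := ∑' k : ℕ, (weightG n x k) ^ 2

/-- The weights `C(n+k,k) x^k (1-x)^(n+1)` connected with the Meyer-König and Zeller operators,
with a real parameter `n` and `0 ≤ x < 1`. -/
def weightJ (n x : ℝ) (k : ℕ) : ℝ :=
  Ring.choose (n + (k : ℝ)) k * x ^ k * (1 - x) ^ (n + 1)

/-- The index of coincidence of the distribution connected with the Meyer-König and Zeller
operators. -/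
def indexJ (n x : ℝ) : ℝ := ∑' k : ℕ, (weightJ n x k) ^ 2

end

open MeasureTheory Real

/-! The generating functions of the weights on the unit circle are powers, `((1 + x e^{iθ})/(1 +
x))^n` for U and `((1 - x)/(1 - x e^{iθ}))^(n+1)` for J. By Parseval each index is the mean over `θ`
of `w^s`, where `w = a + b cos θ ≥ 0` and `s = n`, resp. `s = -(n+1)`. Substituting `x/(1+x)` and `n
- 1` turns J into G. Convexity in the index is the integral of `w^s (w - 1)^2 ≥ 0`. These means also
satisfy Legendre's three-term recurrence (`laplaceIntegral_recurrence`). Eliminating the middle term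
between the two gives the ratio bounds (`le_ratio_mul_of_convex_of_recurrence`). -/

/-! ### Parseval's identity -/

/-- Integrating an absolutely convergent Fourier series with nonnegative frequencies against a
continuous function, term by term. -/
theorem hasSum_integral_fourier_mul {c : ℕ → ℂ} (hc : Summable fun k => ‖c k‖) {F g : ℝ → ℂ}
    (hF : ∀ θ : ℝ, HasSum (fun k : ℕ => c k * Complex.exp (k * θ * Complex.I)) (F θ))
    (hg : Continuous g) :
    HasSum (fun k : ℕ => c k * ∫ θ in (0 : ℝ)..(2 * π), Complex.exp (k * θ * Complex.I) * g θ)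
      (∫ θ in (0 : ℝ)..(2 * π), F θ * g θ) := by
  have key := intervalIntegral.hasSum_integral_of_dominated_convergence (μ := volume)
    (a := 0) (b := 2 * π)
    (F := fun (k : ℕ) (θ : ℝ) => c k * (Complex.exp (k * θ * Complex.I) * g θ))
    (f := fun θ => F θ * g θ) (fun k θ => ‖c k‖ * ‖g θ‖)
    (fun k => by
      refine Continuous.aestronglyMeasurable ?_
      fun_prop)
    (fun k => ae_of_all _ fun θ _ => by
      have : ‖Complex.exp (k * θ * Complex.I)‖ = 1 := by
        exact_mod_cast Complex.norm_exp_ofReal_mul_I ((k : ℝ) * θ)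
      rw [norm_mul, norm_mul, this, one_mul])
    (ae_of_all _ fun θ _ => hc.mul_right _)
    (by
      simp_rw [tsum_mul_right]
      exact (Continuous.intervalIntegrable (by fun_prop) _ _))
    (ae_of_all _ fun θ _ => by
      simpa only [mul_assoc] using (hF θ).mul_right (g θ))
  simpa only [intervalIntegral.integral_const_mul] using key

theorem integral_exp_natCast_sub_natCast (j k : ℕ) :
    ∫ θ in (0 : ℝ)..(2 * π),
      Complex.exp (j * θ * Complex.I) * Complex.exp (-(k * θ * Complex.I)) =
      if j = k then 2 * (π : ℂ) else 0 := by
  have h : ∀ θ : ℝ, Complex.exp (j * θ * Complex.I) * Complex.exp (-(k * θ * Complex.I)) =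
      Complex.exp (((j : ℂ) - k) * Complex.I * θ) := fun θ => by
    rw [← Complex.exp_add]; ring_nf
  simp_rw [h]
  split_ifs with hjk
  · simp [hjk]
  · have hne : ((j : ℂ) - k) * Complex.I ≠ 0 :=
      mul_ne_zero (sub_ne_zero.2 (by exact_mod_cast hjk)) Complex.I_ne_zero
    rw [integral_exp_mul_complex hne]
    have : Complex.exp (((j : ℂ) - k) * Complex.I * ((2 * π : ℝ) : ℂ)) = 1 := by
      rw [Complex.exp_eq_one_iff]
      exact ⟨(j : ℤ) - k, by push_cast; ring⟩
    rw [this]; simp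

/-- **Parseval's identity** for an absolutely convergent Fourier series with nonnegative
frequencies. -/
theorem hasSum_norm_sq_of_hasSum_fourier {c : ℕ → ℂ} (hc : Summable fun k => ‖c k‖) {F : ℝ → ℂ}
    (hF : ∀ θ : ℝ, HasSum (fun k : ℕ => c k * Complex.exp (k * θ * Complex.I)) (F θ))
    (hFc : Continuous F) :
    HasSum (fun k => ‖c k‖ ^ 2) ((∫ θ in (0 : ℝ)..(2 * π), ‖F θ‖ ^ 2) / (2 * π)) := by
  have coeff : ∀ k : ℕ, ∫ θ in (0 : ℝ)..(2 * π), F θ * Complex.exp (-(k * θ * Complex.I)) =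
      c k * (2 * π) := fun k => by
    have h := hasSum_integral_fourier_mul hc hF
      (g := fun θ : ℝ => Complex.exp (-(k * θ * Complex.I))) (by fun_prop)
    simp_rw [integral_exp_natCast_sub_natCast] at h
    refine h.unique ?_
    convert hasSum_ite_eq k (c k * (2 * π)) using 2 with j
    split_ifs with hjk <;> simp [hjk]
  have coeff' : ∀ k : ℕ, ∫ θ in (0 : ℝ)..(2 * π),
      Complex.exp (k * θ * Complex.I) * (starRingEnd ℂ) (F θ) =
      (starRingEnd ℂ) (c k) * (2 * π) := fun k => by
    have h := congrArg (starRingEnd ℂ) (coeff k)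
    rw [← intervalIntegral.intervalIntegral_conj] at h
    simp only [map_mul, ← Complex.exp_conj, map_neg, Complex.conj_I, Complex.conj_ofReal,
      map_natCast, map_ofNat, mul_neg, neg_neg] at h
    rw [← h]
    simp_rw [mul_comm]
  -- Integrating the series of `F` against the conjugate of `F` turns each term into a multiple of
  -- `|c k|^2`.
  have h := hasSum_integral_fourier_mul hc hF (Complex.continuous_conj.comp hFc)
  simp only [Function.comp_apply, coeff', ← mul_assoc, Complex.mul_conj'] at h
  have h2 : HasSum (fun k => ((‖c k‖ ^ 2 * (2 * π) : ℝ) : ℂ))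
      ((∫ θ in (0 : ℝ)..(2 * π), ‖F θ‖ ^ 2 : ℝ) : ℂ) := by
    rw [← intervalIntegral.integral_ofReal]
    push_cast
    simpa only [← mul_assoc] using h
  have h3 := (Complex.hasSum_ofReal.1 h2).div_const (2 * π)
  simpa [mul_div_assoc, pi_ne_zero] using h3

/-! ### Convexity and recurrence for Laplace integrals -/

/-- The unnormalized Laplace integral of Legendre functions, with a real exponent. -/
noncomputable def laplaceIntegral (a b s : ℝ) : ℝ :=
  ∫ θ in (0 : ℝ)..(2 * π), (a + b * cos θ) ^ s

section laplaceIntegral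

variable {a b s : ℝ}

theorem continuous_add_mul_cos_rpow (h : (∀ θ, 0 < a + b * cos θ) ∨ 0 ≤ s) :
    Continuous fun θ : ℝ => (a + b * cos θ) ^ s :=
  Continuous.rpow_const (by fun_prop) fun θ => h.imp (fun h => (h θ).ne') id

theorem rpow_add_one_of_pos_or_nonneg {w : ℝ} (h : 0 < w ∨ 0 ≤ w ∧ 0 ≤ s) :
    w ^ (s + 1) = w * w ^ s := by
  rcases h with h | ⟨h, hs⟩
  · rw [rpow_add_one h.ne', mul_comm]
  · rw [rpow_add_one' h (by positivity), mul_comm]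

/-- The integrand of the difference is `w^s (w - 1)^2`. Of the two alternatives, positivity of `w`
allows the negative exponents of J; `0 ≤ s` allows `w` to vanish, as it does for U at `x = 1`, `θ =
π`. -/
theorem two_mul_laplaceIntegral_le (h : (∀ θ, 0 < a + b * cos θ) ∨
    (∀ θ, 0 ≤ a + b * cos θ) ∧ 0 ≤ s) :
    2 * laplaceIntegral a b (s + 1) ≤ laplaceIntegral a b s + laplaceIntegral a b (s + 2) := by
  have hw : ∀ θ, 0 < a + b * cos θ ∨ 0 ≤ a + b * cos θ ∧ 0 ≤ s := fun θ =>
    h.imp (fun h => h θ) fun h => ⟨h.1 θ, h.2⟩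
  have h0 := (continuous_add_mul_cos_rpow (a := a) (b := b) (s := s)
    (h.imp_right And.right)).intervalIntegrable (μ := volume) 0 (2 * π)
  have h1 := (continuous_add_mul_cos_rpow (a := a) (b := b) (s := s + 1)
    (h.imp_right fun h => by linarith [h.2])).intervalIntegrable (μ := volume) 0 (2 * π)
  have h2 := (continuous_add_mul_cos_rpow (a := a) (b := b) (s := s + 2)
    (h.imp_right fun h => by linarith [h.2])).intervalIntegrable (μ := volume) 0 (2 * π)
  unfold laplaceIntegral
  rw [← intervalIntegral.integral_const_mul, ← intervalIntegral.integral_add h0 h2]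
  refine intervalIntegral.integral_mono_on (by positivity) (h1.const_mul 2) (h0.add h2)
    fun θ _ => ?_
  have e1 := rpow_add_one_of_pos_or_nonneg (hw θ)
  have e2 := rpow_add_one_of_pos_or_nonneg (w := a + b * cos θ) (s := s + 1)
    ((hw θ).imp_right fun h => ⟨h.1, by linarith [h.2]⟩)
  rw [add_assoc, one_add_one_eq_two] at e2
  rw [e2, e1]
  have hnn : 0 ≤ (a + b * cos θ) ^ s := rpow_nonneg ((hw θ).elim le_of_lt And.left) s
  nlinarith [mul_nonneg hnn (sq_nonneg (a + b * cos θ - 1))]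

/-- The three-term recurrence of Legendre functions. -/
theorem laplaceIntegral_recurrence (h : (∀ θ, 0 < a + b * cos θ) ∨
    (∀ θ, 0 ≤ a + b * cos θ) ∧ 0 ≤ s) :
    (s + 2) * laplaceIntegral a b (s + 2) =
      (2 * s + 3) * a * laplaceIntegral a b (s + 1) -
        (s + 1) * (a ^ 2 - b ^ 2) * laplaceIntegral a b s := by
  have hw : ∀ θ, 0 < a + b * cos θ ∨ 0 ≤ a + b * cos θ ∧ 0 ≤ s := fun θ =>
    h.imp (fun h => h θ) fun h => ⟨h.1 θ, h.2⟩
  have c0 := continuous_add_mul_cos_rpow (a := a) (b := b) (s := s) (h.imp_right And.right)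
  have c1 := continuous_add_mul_cos_rpow (a := a) (b := b) (s := s + 1)
    (h.imp_right fun h => by linarith [h.2])
  have c2 := continuous_add_mul_cos_rpow (a := a) (b := b) (s := s + 2)
    (h.imp_right fun h => by linarith [h.2])
  have h0 := c0.intervalIntegrable (μ := volume) 0 (2 * π)
  have h1 := c1.intervalIntegrable (μ := volume) 0 (2 * π)
  have h2 := c2.intervalIntegrable (μ := volume) 0 (2 * π)
  -- With `b cos θ = w - a` and `b^2 sin^2 θ = b^2 - (w - a)^2`, the derivative of `b sin θ w^(s+1)`
  -- is the recurrence; its integral vanishes since `sin` is zero at both ends.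
  have deriv : ∀ θ : ℝ, HasDerivAt (fun t => b * (sin t * (a + b * cos t) ^ (s + 1)))
      ((s + 2) * (a + b * cos θ) ^ (s + 2) - (2 * s + 3) * a * (a + b * cos θ) ^ (s + 1) +
        (s + 1) * (a ^ 2 - b ^ 2) * (a + b * cos θ) ^ s) θ := fun θ => by
    have hd := (((hasDerivAt_cos θ).const_mul b).const_add a).rpow_const (p := s + 1)
      ((hw θ).imp ne_of_gt fun h => by linarith [h.2])
    refine (((hasDerivAt_sin θ).mul hd).const_mul b).congr_deriv ?_
    have e1 := rpow_add_one_of_pos_or_nonneg (hw θ)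
    have e2 := rpow_add_one_of_pos_or_nonneg (w := a + b * cos θ) (s := s + 1)
      ((hw θ).imp_right fun h => ⟨h.1, by linarith [h.2]⟩)
    rw [add_assoc, one_add_one_eq_two] at e2
    rw [e2, e1, add_sub_cancel_right]
    linear_combination (-(s + 1) * b ^ 2 * (a + b * cos θ) ^ s) * sin_sq_add_cos_sq θ
  have key := intervalIntegral.integral_eq_sub_of_hasDerivAt (a := 0) (b := 2 * π)
    (fun θ _ => deriv θ) (((h2.const_mul _).sub (h1.const_mul _)).add (h0.const_mul _))
  rw [intervalIntegral.integral_add ((h2.const_mul _).sub (h1.const_mul _)) (h0.const_mul _),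
    intervalIntegral.integral_sub (h2.const_mul _) (h1.const_mul _)] at key
  simp only [intervalIntegral.integral_const_mul, sin_two_pi, sin_zero, zero_mul, mul_zero,
    sub_zero] at key
  unfold laplaceIntegral
  linarith

end laplaceIntegral

/-! ### Integral representations of the indices -/

theorem norm_one_add_mul_exp_sq (x θ : ℝ) :
    ‖1 + (x : ℂ) * Complex.exp (θ * Complex.I)‖ ^ 2 = 1 + x ^ 2 + 2 * x * cos θ := by
  rw [← Complex.normSq_eq_norm_sq, Complex.normSq_apply]
  simp only [Complex.add_re, Complex.add_im, Complex.one_re, Complex.one_im, Complex.re_ofReal_mul,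
    Complex.im_ofReal_mul, Complex.exp_ofReal_mul_I_re, Complex.exp_ofReal_mul_I_im]
  linear_combination x ^ 2 * sin_sq_add_cos_sq θ

theorem indexU_eq_laplaceIntegral (n : ℕ) {x : ℝ} (hx : 0 ≤ x) :
    indexU n x =
      laplaceIntegral ((1 + x ^ 2) / (1 + x) ^ 2) (2 * x / (1 + x) ^ 2) n / (2 * π) := by
  have h1 : 0 < 1 + x := by positivity
  have hzero : ∀ k ∉ Finset.range (n + 1), (n.choose k : ℝ) * x ^ k / (1 + x) ^ n = 0 :=
    fun k hk => by
      rw [Nat.choose_eq_zero_of_lt (by simpa [Nat.lt_succ_iff] using hk)]; simp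
  have h := hasSum_norm_sq_of_hasSum_fourier
    (c := fun k => (((n.choose k : ℝ) * x ^ k / (1 + x) ^ n : ℝ) : ℂ))
    (F := fun θ : ℝ => ((1 + (x : ℂ) * Complex.exp (θ * Complex.I)) / (1 + (x : ℂ))) ^ n)
    (summable_of_ne_finset_zero (s := Finset.range (n + 1)) fun k hk => by
      rw [hzero k hk]; simp)
    (fun θ => by
      have hsum := hasSum_sum_of_ne_finset_zero (L := .unconditional ℕ)
        (s := Finset.range (n + 1))
        (f := fun k : ℕ => (((n.choose k : ℝ) * x ^ k / (1 + x) ^ n : ℝ) : ℂ) *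
          Complex.exp (k * θ * Complex.I)) (fun k hk => by rw [hzero k hk]; simp)
      convert hsum using 1
      rw [div_pow, add_comm (1 : ℂ) (_ * _), add_pow, Finset.sum_div]
      refine Finset.sum_congr rfl fun k _ => ?_
      rw [mul_assoc (k : ℂ), Complex.exp_nat_mul, mul_pow]
      push_cast
      ring)
    (by fun_prop)
  have h2 := hasSum_sum_of_ne_finset_zero (L := .unconditional ℕ)
    (s := Finset.range (n + 1))
      (f := fun k => ((n.choose k : ℝ) * x ^ k / (1 + x) ^ n) ^ 2) (fun k hk => by
      rw [hzero k hk]; simp)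
  simp only [Complex.norm_real, norm_eq_abs, sq_abs] at h
  rw [indexU, h2.unique h, laplaceIntegral]
  congr 1
  refine intervalIntegral.integral_congr fun θ _ => ?_
  have : ‖1 + (x : ℂ)‖ = 1 + x := by
    rw [← Complex.ofReal_one, ← Complex.ofReal_add, Complex.norm_real, norm_of_nonneg h1.le]
  simp only [norm_pow, norm_div, this]
  rw [← pow_mul, mul_comm n 2, pow_mul, div_pow, norm_one_add_mul_exp_sq, rpow_natCast]
  ring

/-- This is the binomial series of `(1 - x z)^(-(n+1))`. -/
theorem hasSum_weightJ_mul_pow (n : ℝ) {x : ℝ} {z : ℂ} (hz : ‖z‖ = 1) (hx0 : 0 ≤ x) (hx : x < 1) :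
    HasSum (fun k : ℕ => (weightJ n x k : ℂ) * z ^ k)
      (((1 - x) ^ (n + 1) : ℝ) / (1 - x * z) ^ ((n + 1 : ℝ) : ℂ)) := by
  have hxz : ‖(x : ℂ) * z‖ = x := by
    rw [norm_mul, hz, mul_one, Complex.norm_real, norm_of_nonneg hx0]
  have h := (Complex.one_div_one_sub_cpow_hasFPowerSeriesOnBall_zero ((n + 1 : ℝ) : ℂ)).hasSum
    (y := x * z) (by
      rw [mem_eball_zero_iff, ← ofReal_norm, hxz]
      simpa using hx)
  have hterm : ∀ k : ℕ, (weightJ n x k : ℂ) * z ^ k =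
      (((1 - x) ^ (n + 1) : ℝ) : ℂ) * (FormalMultilinearSeries.ofScalars ℂ
        (fun k : ℕ => Ring.choose (((n + 1 : ℝ) : ℂ) + k - 1) k) k fun _ => (x : ℂ) * z) :=
    fun k => by
    have : Ring.choose (((n + 1 : ℝ) : ℂ) + k - 1) k = ((Ring.choose (n + k) k : ℝ) : ℂ) := by
      rw [Complex.ofReal_choose]
      push_cast
      ring_nf
    rw [FormalMultilinearSeries.ofScalars_apply_eq, weightJ, this, smul_eq_mul]
    push_cast
    ring
  simp only [hterm]
  simpa only [zero_add, mul_one_div] using h.mul_left (((1 - x) ^ (n + 1) : ℝ) : ℂ)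

theorem summable_norm_weightJ (n : ℝ) {x : ℝ} (hx0 : 0 ≤ x) (hx : x < 1) :
    Summable fun k => ‖(weightJ n x k : ℂ)‖ := by
  -- Summability in `ℂ` is unconditional, hence absolute, so the point `z = 1` suffices.
  have h := (hasSum_weightJ_mul_pow n (z := 1) (by simp) hx0 hx).summable.norm
  simpa using h

theorem hasSum_sq_weightJ (n : ℝ) {x : ℝ} (hx0 : 0 ≤ x) (hx : x < 1) :
    HasSum (fun k => weightJ n x k ^ 2)
      (laplaceIntegral ((1 + x ^ 2) / (1 - x) ^ 2) (-2 * x / (1 - x) ^ 2) (-(n + 1)) /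
        (2 * π)) := by
  have h1 : 0 < 1 - x := by linarith
  have hslit : ∀ θ : ℝ, 1 - (x : ℂ) * Complex.exp (θ * Complex.I) ∈ Complex.slitPlane := fun θ => by
    refine Complex.mem_slitPlane_of_norm_lt_one (z := -((x : ℂ) * Complex.exp (θ * Complex.I))) ?_
    rwa [norm_neg, norm_mul, Complex.norm_exp_ofReal_mul_I, mul_one, Complex.norm_real,
      norm_of_nonneg hx0]
  have h := hasSum_norm_sq_of_hasSum_fourier (c := fun k => (weightJ n x k : ℂ))
    (F := fun θ : ℝ => ((1 - x) ^ (n + 1) : ℝ) /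
      (1 - x * Complex.exp (θ * Complex.I)) ^ ((n + 1 : ℝ) : ℂ))
    (summable_norm_weightJ n hx0 hx)
    (fun θ => by
      convert hasSum_weightJ_mul_pow n (Complex.norm_exp_ofReal_mul_I θ) hx0 hx using 3 with k
      rw [mul_assoc (k : ℂ), Complex.exp_nat_mul])
    (continuous_const.div (Continuous.cpow (by fun_prop) continuous_const hslit) fun θ =>
      (Complex.cpow_ne_zero_iff).2 (.inl (Complex.slitPlane_ne_zero (hslit θ))))
  simp only [Complex.norm_real, norm_eq_abs, sq_abs] at h
  convert h using 2
  refine intervalIntegral.integral_congr fun θ _ => ?_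
  have hw := norm_one_add_mul_exp_sq (-x) θ
  rw [Complex.ofReal_neg, neg_mul, ← sub_eq_add_neg] at hw
  have hN : 0 ≤ ‖1 - (x : ℂ) * Complex.exp (θ * Complex.I)‖ := norm_nonneg _
  simp only [norm_div, Complex.norm_cpow_real, Complex.norm_real,
    norm_of_nonneg (rpow_nonneg h1.le (n + 1))]
  rw [← div_rpow h1.le hN, rpow_pow_comm (div_nonneg h1.le hN), div_pow, hw, rpow_neg_eq_inv_rpow,
    div_mul_eq_mul_div, ← add_div, inv_div]
  ring_nf

theorem indexJ_eq_laplaceIntegral (n : ℝ) {x : ℝ} (hx0 : 0 ≤ x) (hx : x < 1) :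
    indexJ n x =
      laplaceIntegral ((1 + x ^ 2) / (1 - x) ^ 2) (-2 * x / (1 - x) ^ 2) (-(n + 1)) / (2 * π) :=
  (hasSum_sq_weightJ n hx0 hx).tsum_eq

theorem weightG_eq_weightJ (n : ℝ) {x : ℝ} (hx : 0 ≤ x) (k : ℕ) :
    weightG n x k = weightJ (n - 1) (x / (1 + x)) k := by
  have h1 : 0 < 1 + x := by positivity
  have h2 : 1 - x / (1 + x) = (1 + x)⁻¹ := by field_simp; ring
  rw [weightG, weightJ, h2, inv_rpow h1.le, ← rpow_neg h1.le, sub_eq_add_neg (-n),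
    rpow_add h1, rpow_neg h1.le (k : ℝ), rpow_natCast, div_pow, sub_add_cancel,
    sub_add_eq_add_sub]
  ring

theorem indexG_eq_indexJ (n : ℝ) {x : ℝ} (hx : 0 ≤ x) :
    indexG n x = indexJ (n - 1) (x / (1 + x)) := by
  simp only [indexG, indexJ, weightG_eq_weightJ n hx]

/-! ### From convexity and recurrence to the inequalities -/

/-- Convexity and the three-term recurrence together bound the ratios of consecutive terms. -/
theorem le_ratio_mul_of_convex_of_recurrence {m x A₀ A₁ A₂ : ℝ} (hm : 0 ≤ m) (hx : 0 ≤ x)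
    (hconv : 2 * A₁ ≤ A₀ + A₂)
    (hrec : (m + 1) * (1 + x) ^ 2 * A₂ =
      (2 * m + 1) * (1 + x ^ 2) * A₁ - m * (1 - x) ^ 2 * A₀) :
    2 * A₁ ≤ A₀ + A₂ ∧
      A₂ ≤ (1 + 4 * m * x + x ^ 2) / (1 + (4 * m + 4) * x + x ^ 2) * A₀ ∧
      A₁ ≤ (1 + (4 * m + 2) * x + x ^ 2) / (1 + (4 * m + 4) * x + x ^ 2) * A₀ := by
  have hpos : 0 < 1 + (4 * m + 4) * x + x ^ 2 := by positivity
  have key : A₂ * (1 + (4 * m + 4) * x + x ^ 2) ≤ (1 + 4 * m * x + x ^ 2) * A₀ := by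
    -- The factor is the coefficient of `A₁` in the recurrence, so that `A₁` can be eliminated.
    have := mul_le_mul_of_nonneg_left hconv (show 0 ≤ (2 * m + 1) * (1 + x ^ 2) by positivity)
    linarith
  refine ⟨hconv, ?_, ?_⟩
  · rwa [div_mul_eq_mul_div, le_div_iff₀ hpos]
  · rw [div_mul_eq_mul_div, le_div_iff₀ hpos]
    -- Inserting `key` bounds `A₁` by `A₀` times the average of 1 and the previous ratio.
    have := mul_le_mul_of_nonneg_right hconv hpos.le
    linarith

theorem indexU_inequalities {n : ℕ} {x : ℝ} (hn : 1 ≤ n) (hx : 0 ≤ x) :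
    2 * indexU n x ≤ indexU (n - 1) x + indexU (n + 1) x ∧
      indexU (n + 1) x ≤
        (1 + 4 * (n : ℝ) * x + x ^ 2) / (1 + (4 * (n : ℝ) + 4) * x + x ^ 2) *
          indexU (n - 1) x ∧
      indexU n x ≤
        (1 + (4 * (n : ℝ) + 2) * x + x ^ 2) / (1 + (4 * (n : ℝ) + 4) * x + x ^ 2) *
          indexU (n - 1) x := by
  obtain ⟨m, rfl⟩ : ∃ m, n = m + 1 := ⟨n - 1, by omega⟩
  have h1 : 0 < 1 + x := by positivity
  have hw : ∀ θ, 0 ≤ (1 + x ^ 2) / (1 + x) ^ 2 + 2 * x / (1 + x) ^ 2 * cos θ := fun θ => by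
    rw [div_mul_eq_mul_div, ← add_div]
    refine div_nonneg ?_ (sq_nonneg _)
    nlinarith [neg_one_le_cos θ, sq_nonneg (1 - x)]
  have hconv := two_mul_laplaceIntegral_le (s := m) (.inr ⟨hw, m.cast_nonneg⟩)
  have hrec := laplaceIntegral_recurrence (s := m) (.inr ⟨hw, m.cast_nonneg⟩)
  refine le_ratio_mul_of_convex_of_recurrence (by positivity) hx ?_ ?_
  all_goals
    simp only [add_tsub_cancel_right, indexU_eq_laplaceIntegral _ hx, Nat.cast_add, Nat.cast_one]
    rw [add_assoc (m : ℝ) 1 1, one_add_one_eq_two]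
  · rw [← add_div, ← mul_div_assoc]
    gcongr
  · have hab : ((1 + x ^ 2) / (1 + x) ^ 2) ^ 2 - (2 * x / (1 + x) ^ 2) ^ 2 =
        (1 - x) ^ 2 / (1 + x) ^ 2 := by
      field_simp; ring
    rw [hab] at hrec
    field_simp
    field_simp at hrec
    linear_combination hrec

/-- The range `0 ≤ n` is what G requires for `n ≥ 1`, because of its index shift. -/
theorem indexJ_inequalities {n x : ℝ} (hn : 0 ≤ n) (hx0 : 0 ≤ x) (hx : x < 1) :
    2 * indexJ n x ≤ indexJ (n - 1) x + indexJ (n + 1) x ∧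
      indexJ (n + 1) x ≤
        (1 + 4 * n * x + x ^ 2) / (1 + (4 * n + 4) * x + x ^ 2) * indexJ (n - 1) x ∧
      indexJ n x ≤
        (1 + (4 * n + 2) * x + x ^ 2) / (1 + (4 * n + 4) * x + x ^ 2) *
          indexJ (n - 1) x := by
  have h1 : 0 < 1 - x := by linarith
  have hw : ∀ θ, 0 < (1 + x ^ 2) / (1 - x) ^ 2 + -2 * x / (1 - x) ^ 2 * cos θ := fun θ => by
    rw [div_mul_eq_mul_div, ← add_div]
    refine div_pos ?_ (by positivity)
    nlinarith [cos_le_one θ, mul_pos h1 h1]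
  -- The exponent decreases as `n` grows: `s` belongs to `n + 1` and `s + 2` to `n - 1`. The
  -- recurrence is thus read backwards, with all signs flipped.
  have hconv := two_mul_laplaceIntegral_le (s := -(n + 1 + 1)) (.inl hw)
  have hrec := laplaceIntegral_recurrence (s := -(n + 1 + 1)) (.inl hw)
  have e1 : -(n + 1 + 1) + 1 = -(n + 1) := by ring
  have e2 : -(n + 1 + 1) + 2 = -(n - 1 + 1) := by ring
  rw [e1, e2] at hconv hrec
  refine le_ratio_mul_of_convex_of_recurrence hn hx0 ?_ ?_
  all_goals simp only [indexJ_eq_laplaceIntegral _ hx0 hx]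
  · rw [← add_div, ← mul_div_assoc, add_comm (laplaceIntegral _ _ (-(n - 1 + 1)))]
    gcongr
  · have hab : ((1 + x ^ 2) / (1 - x) ^ 2) ^ 2 - (-2 * x / (1 - x) ^ 2) ^ 2 =
        (1 + x) ^ 2 / (1 - x) ^ 2 := by
      field_simp; ring
    rw [hab] at hrec
    have h1' := h1.ne'
    field_simp
    field_simp at hrec
    linear_combination -hrec

theorem indexG_inequalities {n x : ℝ} (hn : 1 ≤ n) (hx : 0 ≤ x) :
    2 * indexG n x ≤ indexG (n - 1) x + indexG (n + 1) x ∧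
      indexG (n + 1) x ≤
        (1 + (4 * n - 2) * x * (1 + x)) / (1 + (4 * n + 2) * x * (1 + x)) *
          indexG (n - 1) x ∧
      indexG n x ≤
        (1 + 4 * n * x * (x + 1)) / (1 + (4 * n + 2) * x * (x + 1)) *
          indexG (n - 1) x := by
  have h1 : 0 < 1 + x := by positivity
  have h := indexJ_inequalities (n := n - 1) (x := x / (1 + x)) (by linarith) (by positivity)
    (by rw [div_lt_one h1]; linarith)
  -- The shift `p + 2` comes from `(1 + x)^2 + x^2 = 1 + 2x(1 + x)`; the denominators `(1 + x)^2`
  -- cancel in the ratios.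
  have scale : ∀ p : ℝ, 1 + p * (x / (1 + x)) + (x / (1 + x)) ^ 2 =
      (1 + (p + 2) * x * (1 + x)) / (1 + x) ^ 2 := fun p => by
    field_simp; ring
  simp only [scale, div_div_div_cancel_right₀ (pow_ne_zero 2 h1.ne')] at h
  simp only [indexG_eq_indexJ _ hx, add_comm x 1]
  convert h using 6 <;> ring

theorem theorem3p2 :
    (∀ (n : ℕ) (x : ℝ), 1 ≤ n → 0 ≤ x →
      2 * indexU n x ≤ indexU (n - 1) x + indexU (n + 1) x ∧
      indexU (n + 1) x ≤
        (1 + 4 * (n : ℝ) * x + x ^ 2) / (1 + (4 * (n : ℝ) + 4) * x + x ^ 2) *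
          indexU (n - 1) x ∧
      indexU n x ≤
        (1 + (4 * (n : ℝ) + 2) * x + x ^ 2) / (1 + (4 * (n : ℝ) + 4) * x + x ^ 2) *
          indexU (n - 1) x) ∧
    (∀ n x : ℝ, 0 ≤ n → 0 ≤ x → Summable (fun k : ℕ => (weightG n x k) ^ 2)) ∧
    (∀ n x : ℝ, 1 ≤ n → 0 ≤ x →
      2 * indexG n x ≤ indexG (n - 1) x + indexG (n + 1) x ∧
      indexG (n + 1) x ≤
        (1 + (4 * n - 2) * x * (1 + x)) / (1 + (4 * n + 2) * x * (1 + x)) *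
          indexG (n - 1) x ∧
      indexG n x ≤
        (1 + 4 * n * x * (x + 1)) / (1 + (4 * n + 2) * x * (x + 1)) *
          indexG (n - 1) x) ∧
    (∀ n x : ℝ, 0 ≤ n → 0 ≤ x → x < 1 → Summable (fun k : ℕ => (weightJ n x k) ^ 2)) ∧
    (∀ n x : ℝ, 1 ≤ n → 0 ≤ x → x < 1 →
      2 * indexJ n x ≤ indexJ (n - 1) x + indexJ (n + 1) x ∧
      indexJ (n + 1) x ≤
        (1 + 4 * n * x + x ^ 2) / (1 + (4 * n + 4) * x + x ^ 2) * indexJ (n - 1) x ∧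
      indexJ n x ≤
        (1 + (4 * n + 2) * x + x ^ 2) / (1 + (4 * n + 4) * x + x ^ 2) *
          indexJ (n - 1) x) := by
  refine ⟨fun n x hn hx => indexU_inequalities hn hx, fun n x _ hx => ?_,
    fun n x hn hx => indexG_inequalities hn hx,
    fun n x _ hx0 hx => (hasSum_sq_weightJ n hx0 hx).summable,
    fun n x hn hx0 hx => indexJ_inequalities (zero_le_one.trans hn) hx0 hx⟩
  have h1 : 0 < 1 + x := by positivity
  simp only [weightG_eq_weightJ n hx]
  exact (hasSum_sq_weightJ (n - 1) (by positivity)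
    (by rw [div_lt_one h1]; linarith)).summable
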